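/- Let $X$ be a real Banach space which contains an isomorphic copy of $c_0$, i.e. some linear subspace of $X$ is linearly homeomorphic to $c_0$. Then there exists an equivalent norm $p$ on $X$ such that, for every integer $N\ge 1$, the symmetric projective tensor product $\widehat{\otimes}_{\pi,s,N}(X,p)$ has the strong diameter two property. Here, for a real Banach space $Z$ with unit sphere $S_Z$ and an integer $N\geq 1$, $\widehat{\otimes}_{\pi,s,N}Z$ is the completion of the linear span of the tensors $z^N:=z\otimes\cdots\otimes z$ ($N$ factors), $z\in Z$, in the algebraic $N$-fold tensor product of $Z$, under the norm $$\Vert u\Vert:=\inf\left\{\sum_{i=1}^k|\lambda_i| : u=\sum_{i=1}^k\lambda_i z_i^N,\ k\in\mathbb{N}\cup\{0\},\ \lambda_i\in\mathbb R,\ z_i\in S_Z\right\}.$$ A Banach space $Y$ with closed unit ball $B_Y$ has the strong diameter two property if every convex combination of slices of $B_Y$ has diameter two: for all $k\ge 1$, all $f_1,\dots,f_k\in Y^*$ with $\Vert f_i\Vert=1$, all $\alpha_i>0$ and all $\lambda_i\ge 0$ with $\sum_{i=1}^k\lambda_i=1$, the set $\sum_{i=1}^k\lambda_i\{y\in B_Y: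 f_i(y)>1-\alpha_i\}$ has diameter $2$. -/

import Mathlib

open scoped TensorProduct ZeroAtInfty

noncomputable section

/-! ### Equivalent norms -/

/-- An equivalent norm on the normed space `X`: a seminorm `p` with
`c ‖x‖ ≤ p x ≤ C ‖x‖` for some constants `c > 0` and `C`. -/
structure EquivalentNorm (X : Type*) [NormedAddCommGroup X] [NormedSpace ℝ X] where
  toSeminorm : Seminorm ℝ X
  lower : ∃ c : ℝ, 0 < c ∧ ∀ x : X, c * ‖x‖ ≤ toSeminorm x
  upper : ∃ C : ℝ, ∀ x : X, toSeminorm x ≤ C * ‖x‖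

/-- The vector space `X` endowed with the equivalent norm `p` (a type synonym of `X`). -/
def Renormed {X : Type*} [NormedAddCommGroup X] [NormedSpace ℝ X] (_p : EquivalentNorm X) :
    Type _ := X

namespace Renormed

variable {X : Type*} [NormedAddCommGroup X] [NormedSpace ℝ X] (p : EquivalentNorm X)

instance instAddCommGroup : AddCommGroup (Renormed p) := inferInstanceAs (AddCommGroup X)

instance instModule : Module ℝ (Renormed p) := inferInstanceAs (Module ℝ X)

instance instNorm : Norm (Renormed p) := ⟨fun x => p.toSeminorm x⟩

theorem core : NormedSpace.Core ℝ (Renormed p) where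
  norm_nonneg x := apply_nonneg p.toSeminorm x
  norm_smul c x := map_smul_eq_mul p.toSeminorm c x
  norm_triangle x y := map_add_le_add p.toSeminorm x y
  norm_eq_zero_iff x := by
    constructor
    · intro h
      obtain ⟨c, hc, hl⟩ := p.lower
      have h1 : c * ‖(show X from x)‖ ≤ 0 := (hl x).trans (le_of_eq h)
      have h2 : ‖(show X from x)‖ ≤ 0 := by
        by_contra h3
        exact absurd h1 (not_le.mpr (mul_pos hc (not_le.mp h3)))
      exact norm_le_zero_iff.mp h2
    · rintro rfl
      exact map_zero p.toSeminorm

instance instNormedAddCommGroup : NormedAddCommGroup (Renormed p) :=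
  NormedAddCommGroup.ofCore (core p)

instance instNormedSpace : NormedSpace ℝ (Renormed p) where
  norm_smul_le c x := ((core p).norm_smul c x).le

end Renormed

/-! ### The symmetric projective tensor product -/

section Symmetric

variable (N : ℕ) (X : Type*) [NormedAddCommGroup X] [NormedSpace ℝ X]

/-- The tensor `x ^ N = x ⊗ ⋯ ⊗ x` (`N` factors). -/
def tensorPow {X : Type*} [NormedAddCommGroup X] [NormedSpace ℝ X] (x : X) :
    ⨂[ℝ] _ : Fin N, X :=
  PiTensorProduct.tprod ℝ (fun _ => x)

/-- The algebraic symmetric `N`-fold tensor product of `X`: the linear span of the tensors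
`x ^ N`, `x ∈ X`, in the algebraic `N`-fold tensor product.  It is declared as a new type, so that
it does not inherit the norm of the full projective tensor product. -/
def SymTensor : Type _ :=
  ↥(Submodule.span ℝ (Set.range (tensorPow N : X → ⨂[ℝ] _ : Fin N, X)))

namespace SymTensor

instance instAddCommGroup : AddCommGroup (SymTensor N X) :=
  Submodule.addCommGroup (Submodule.span ℝ (Set.range (tensorPow N : X → ⨂[ℝ] _ : Fin N, X)))

instance instModule : Module ℝ (SymTensor N X) :=
  Submodule.module (Submodule.span ℝ (Set.range (tensorPow N : X → ⨂[ℝ] _ : Fin N, X)))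

variable {X}

/-- The tensor `x ^ N` as an element of the symmetric tensor product. -/
def pow (x : X) : SymTensor N X := ⟨tensorPow N x, Submodule.subset_span ⟨x, rfl⟩⟩

variable {N}

/-- The set of all the sums `∑ |λ i|` over the finite representations `z = ∑ λ i • (x i) ^ N` with
real `λ i` and with `x i` in the unit sphere of `X`. -/
def costs (z : SymTensor N X) : Set ℝ :=
  {r | ∃ (k : ℕ) (c : Fin k → ℝ) (x : Fin k → X),
    (∀ i, ‖x i‖ = 1) ∧ z = ∑ i, c i • pow N (x i) ∧ r = ∑ i, |c i|}

/-- The symmetric projective norm: the infimum of `∑ |λ i|` over all representations. -/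
instance instNorm : Norm (SymTensor N X) := ⟨fun z => sInf (costs z)⟩

theorem norm_def (z : SymTensor N X) : ‖z‖ = sInf (costs z) := rfl

theorem nonneg_of_mem_costs {z : SymTensor N X} {r : ℝ} (h : r ∈ costs z) : 0 ≤ r := by
  obtain ⟨k, c, x, -, -, rfl⟩ := h
  exact Finset.sum_nonneg fun i _ => abs_nonneg _

theorem bddBelow_costs (z : SymTensor N X) : BddBelow (costs z) :=
  ⟨0, fun _ h => nonneg_of_mem_costs h⟩

theorem zero_mem_costs : (0 : ℝ) ∈ costs (0 : SymTensor N X) :=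
  ⟨0, Fin.elim0, Fin.elim0, fun i => i.elim0, by simp, by simp⟩

theorem add_mem_costs {z w : SymTensor N X} {r s : ℝ} (hr : r ∈ costs z) (hs : s ∈ costs w) :
    r + s ∈ costs (z + w) := by
  obtain ⟨k, c, x, hx, rfl, rfl⟩ := hr
  obtain ⟨l, d, y, hy, rfl, rfl⟩ := hs
  refine ⟨k + l, Fin.append c d, Fin.append x y, ?_, ?_, ?_⟩
  · intro i
    refine Fin.addCases (fun i => ?_) (fun i => ?_) i
    · simpa using hx i
    · simpa using hy i
  · simp [Fin.sum_univ_add]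
  · simp [Fin.sum_univ_add]

theorem smul_mem_costs {z : SymTensor N X} {r : ℝ} (a : ℝ) (hr : r ∈ costs z) :
    |a| * r ∈ costs (a • z) := by
  obtain ⟨k, c, x, hx, rfl, rfl⟩ := hr
  exact ⟨k, fun i => a * c i, x, hx, by simp [Finset.smul_sum, mul_smul],
    by simp [Finset.mul_sum, abs_mul]⟩

theorem costs_nonempty [Nontrivial X] (z : SymTensor N X) : (costs z).Nonempty := by
  obtain ⟨z, hz⟩ := z
  induction hz using Submodule.span_induction with
  | zero => exact ⟨0, zero_mem_costs⟩
  | add u v hu hv ihu ihv =>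
    obtain ⟨r, hr⟩ := ihu
    obtain ⟨s, hs⟩ := ihv
    exact ⟨r + s, add_mem_costs hr hs⟩
  | smul a u hu ihu =>
    obtain ⟨r, hr⟩ := ihu
    exact ⟨|a| * r, smul_mem_costs a hr⟩
  | mem u hu =>
    obtain ⟨x, rfl⟩ := hu
    obtain ⟨e, he⟩ := exists_norm_eq X (zero_le_one' ℝ)
    obtain ⟨v, hv, hxv⟩ : ∃ v : X, ‖v‖ = 1 ∧ x = ‖x‖ • v := by
      by_cases hx : x = 0
      · exact ⟨e, he, by simp [hx]⟩
      · have hx' : ‖x‖ ≠ 0 := norm_ne_zero_iff.mpr hx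
        exact ⟨‖x‖⁻¹ • x, by simp [norm_smul, hx'], by simp [smul_smul, hx']⟩
    refine ⟨_, 1, fun _ => ‖x‖ ^ N, fun _ => v, fun _ => hv, ?_, rfl⟩
    apply Subtype.ext
    have h : tensorPow N x = ‖x‖ ^ N • tensorPow N v := by
      conv_lhs => rw [hxv]
      unfold tensorPow
      have := (PiTensorProduct.tprod ℝ (s := fun _ : Fin N => X)).map_smul_univ
        (fun _ => ‖x‖) (fun _ => v)
      simpa using this
    rw [Fin.sum_univ_one]
    exact h

theorem norm_eq_zero_of_subsingleton [Subsingleton X] (z : SymTensor N X) : ‖z‖ = 0 := by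
  rw [norm_def]
  have h : costs z ⊆ {0} := by
    rintro r ⟨k, c, x, hx, -, rfl⟩
    have hk : IsEmpty (Fin k) := ⟨fun i => by
      have h1 := hx i
      rw [Subsingleton.elim (x i) 0, norm_zero] at h1
      exact zero_ne_one h1⟩
    simp
  rcases Set.subset_singleton_iff_eq.mp h with h | h <;> simp [h]

variable (N X)

theorem core : SeminormedSpace.Core ℝ (SymTensor N X) where
  norm_nonneg z := Real.sInf_nonneg fun _ h => nonneg_of_mem_costs h
  norm_smul a z := by
    rcases subsingleton_or_nontrivial X with _ | _
    · simp [norm_eq_zero_of_subsingleton]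
    · have key : ∀ (b : ℝ) (w : SymTensor N X), ‖b • w‖ ≤ |b| * ‖w‖ := by
        intro b w
        rw [norm_def w, ← smul_eq_mul, ← Real.sInf_smul_of_nonneg (abs_nonneg b)]
        refine le_csInf ((costs_nonempty w).smul_set) ?_
        rintro _ ⟨r, hr, rfl⟩
        exact csInf_le (bddBelow_costs _) (smul_mem_costs b hr)
      refine le_antisymm (key a z) ?_
      by_cases ha : a = 0
      · subst ha
        rw [norm_zero, zero_mul, norm_def]
        exact Real.sInf_nonneg fun _ h => nonneg_of_mem_costs h
      · have h := key a⁻¹ (a • z)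
        rw [smul_smul, inv_mul_cancel₀ ha, one_smul, abs_inv] at h
        have ha' : 0 < |a| := abs_pos.mpr ha
        calc ‖a‖ * ‖z‖ ≤ |a| * (|a|⁻¹ * ‖a • z‖) := mul_le_mul_of_nonneg_left h ha'.le
          _ = ‖a • z‖ := by rw [← mul_assoc, mul_inv_cancel₀ ha'.ne', one_mul]
  norm_triangle z w := by
    rcases subsingleton_or_nontrivial X with _ | _
    · simp [norm_eq_zero_of_subsingleton]
    · rw [norm_def z, norm_def w,
        ← csInf_add (costs_nonempty z) (bddBelow_costs z) (costs_nonempty w) (bddBelow_costs w)]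
      refine le_csInf ((costs_nonempty z).add (costs_nonempty w)) ?_
      rintro _ ⟨r, hr, s, hs, rfl⟩
      exact csInf_le (bddBelow_costs _) (add_mem_costs hr hs)

instance instSeminormedAddCommGroup : SeminormedAddCommGroup (SymTensor N X) :=
  SeminormedAddCommGroup.ofCore (core N X)

instance instNormedSpace : NormedSpace ℝ (SymTensor N X) where
  norm_smul_le c z := ((core N X).norm_smul c z).le

end SymTensor

/-- The symmetric projective `N`-tensor product of `X`: the completion of the linear span of the
tensors `x ^ N` under the symmetric projective norm. -/
abbrev SymProjTensor : Type _ := UniformSpace.Completion (SymTensor N X)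

end Symmetric

/-! ### The strong diameter two property -/

section Diameter

variable {Y : Type*} [NormedAddCommGroup Y] [NormedSpace ℝ Y]

/-- The slice `{y ∈ B_Y : f y > 1 - α}` of the closed unit ball; it is used for norm-one
functionals `f` (so `1 = sup f (B_Y)`) and for `α > 0`. -/
def ballSlice (f : StrongDual ℝ Y) (α : ℝ) : Set Y :=
  {y | ‖y‖ ≤ 1 ∧ 1 - α < f y}

variable (Y)

/-- The strong diameter two property: every convex combination `∑ λ i S i` of slices of the closed
unit ball has diameter two. -/
def StrongDiameterTwo : Prop :=
  ∀ (k : ℕ) (f : Fin k → StrongDual ℝ Y) (α l : Fin k → ℝ),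
    (∀ i, ‖f i‖ = 1) → (∀ i, 0 < α i) → (∀ i, 0 ≤ l i) → ∑ i, l i = 1 →
      Metric.diam {z : Y | ∃ s : Fin k → Y,
        (∀ i, s i ∈ ballSlice (f i) (α i)) ∧ z = ∑ i, l i • s i} = 2

end Diameter

/-- `X` contains an isomorphic copy of `c₀`: some linear subspace of `X` is linearly homeomorphic
to the space `C₀(ℕ, ℝ)` of real sequences tending to zero, with the supremum norm. -/
def ContainsC0 (X : Type*) [NormedAddCommGroup X] [NormedSpace ℝ X] : Prop :=
  ∃ E : Submodule ℝ X, Nonempty (C₀(ℕ, ℝ) ≃L[ℝ] E)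

end

/-! Let `f n` be Hahn–Banach extensions of the coordinate functionals of the copy `E` of `c₀`, with
dual unit vectors `e n`. The norm is `p x = max (sup |f n x|) ‖x + E‖`, chosen independently of `N`:
adding a multiple of `e n` changes only the coordinate `f n`, so that coordinate of a point of the
ball can be reset to any value in `[-1, 1]` without leaving the ball. A polynomial bounded on balls
hardly notices a bounded change along `e n` for large `n` (`tendsto_of_isPolyDeg`). Functionals on
the symmetric tensor product are such polynomials on powers, so finitely many slice points `± x ^ N`
stay in their slices while `N` common coordinates are prescribed (`exists_perturbation`). The
functional of `∏ j, f (n j)` has norm at most one and takes the values `1` and `-1` at two suitably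
perturbed convex combinations, which are therefore at distance at least two. -/

open Filter Topology

/-! ### Polynomials via iterated differences -/

/-- `IsPolyDeg d φ` says that all iterated differences of `φ` of order `d + 1` vanish. -/
def IsPolyDeg {Z : Type*} [AddCommGroup Z] : ℕ → (Z → ℝ) → Prop
  | 0, φ => ∀ x y, φ x = φ y
  | d + 1, φ => ∀ h, IsPolyDeg d (fun x => φ (x + h) - φ x)

namespace IsPolyDeg

variable {Z : Type*} [AddCommGroup Z]

theorem const (c : ℝ) : ∀ d : ℕ, IsPolyDeg d (fun _ : Z => c)
  | 0 => fun _ _ => rfl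
  | d + 1 => fun h => by simpa using const 0 d

theorem add : ∀ {d : ℕ} {φ ψ : Z → ℝ}, IsPolyDeg d φ → IsPolyDeg d ψ →
    IsPolyDeg d (fun x => φ x + ψ x)
  | 0, _, _, hφ, hψ => fun x y => congrArg₂ (· + ·) (hφ x y) (hψ x y)
  | d + 1, φ, ψ, hφ, hψ => fun h => by
    have := add (hφ h) (hψ h)
    convert this using 2
    ring

theorem sum {ι : Type*} {d : ℕ} (s : Finset ι) {φ : ι → Z → ℝ}
    (hφ : ∀ i ∈ s, IsPolyDeg d (φ i)) : IsPolyDeg d (fun x => ∑ i ∈ s, φ i x) := by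
  classical
  induction s using Finset.induction_on with
  | empty => simpa using const 0 d
  | insert a s ha ih =>
    simp only [Finset.sum_insert ha]
    exact (hφ a (by simp)).add (ih fun i hi => hφ i (by simp [hi]))

/-- Expanding at `x + h` and removing the term with `x` in every slot of `s` leaves terms with fewer
free slots. The frozen arguments `c` make the induction possible. -/
theorem multilinear_piecewise [Module ℝ Z] {ι : Type*} [Fintype ι] [DecidableEq ι]
    (m : MultilinearMap ℝ (fun _ : ι => Z) ℝ) :
    ∀ (d : ℕ) (s : Finset ι) (c : ι → Z), s.card ≤ d →
      IsPolyDeg d (fun x => m (s.piecewise (fun _ => x) c))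
  | 0, s, c, hs => by
    obtain rfl : s = ∅ := Finset.card_eq_zero.mp (Nat.le_zero.mp hs)
    intro x y
    simp
  | d + 1, s, c, hs => by
    intro h
    have key : ∀ x, m (s.piecewise (fun _ => x + h) c) - m (s.piecewise (fun _ => x) c) =
        ∑ t ∈ s.powerset.erase s,
          m (t.piecewise (fun _ => x) (s.piecewise (fun _ => h) c)) := by
      intro x
      have h1 := m.map_piecewise_add (fun _ => x) (s.piecewise (fun _ => h) c) s
      have h2 : s.piecewise ((fun _ => x) + s.piecewise (fun _ => h) c)
          (s.piecewise (fun _ => h) c) = s.piecewise (fun _ => x + h) c := by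
        funext i
        by_cases hi : i ∈ s <;> simp [hi]
      have h3 : s.piecewise (fun _ => x) (s.piecewise (fun _ => h) c) =
          s.piecewise (fun _ => x) c := by
        funext i
        by_cases hi : i ∈ s <;> simp [hi]
      rw [h2, ← Finset.add_sum_erase _ _ (Finset.mem_powerset_self s), h3] at h1
      rw [h1]; ring
    simp only [key]
    refine sum _ fun t ht => multilinear_piecewise m d t _ ?_
    rw [Finset.mem_erase, Finset.mem_powerset] at ht
    have := Finset.card_lt_card (ht.2.ssubset_of_ne ht.1)
    omega

theorem multilinear_diag [Module ℝ Z] {N : ℕ} (m : MultilinearMap ℝ (fun _ : Fin N => Z) ℝ) :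
    IsPolyDeg N (fun x => m (fun _ => x)) := by
  simpa using multilinear_piecewise m N Finset.univ 0 (by simp)

end IsPolyDeg

/-! ### Polynomials along a sup-norm system -/

/-- A biorthogonal system along which the norm behaves like the supremum norm: moving a point in
the direction `e n` only affects the norm through the coordinate `f n`. -/
structure SupSystem (Z : Type*) [NormedAddCommGroup Z] [NormedSpace ℝ Z] where
  e : ℕ → Z
  f : ℕ → Z →ₗ[ℝ] ℝ
  apply_self : ∀ n, f n (e n) = 1
  apply_ne : ∀ {m n}, m ≠ n → f m (e n) = 0
  abs_le : ∀ n x, |f n x| ≤ ‖x‖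
  norm_add_le : ∀ x n (a : ℝ), ‖x + a • e n‖ ≤ max ‖x‖ |f n x + a|

namespace SupSystem

variable {Z : Type*} [NormedAddCommGroup Z] [NormedSpace ℝ Z] (B : SupSystem Z)

/-- Since increments at any `y` are asymptotically those at `x`, repeated gains over `ε` would
accumulate: `φ` would be unbounded on a ball, because vectors added in distinct directions `e n` do
not add up in norm. -/
theorem not_frequently_lt {φ : Z → ℝ} (hb : ∀ R, ∃ M, ∀ x, ‖x‖ ≤ R → |φ x| ≤ M)
    {a : ℕ → ℝ} {A : ℝ} (ha : ∀ n, |a n| ≤ A) (x : Z)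
    (hφ : ∀ y, Tendsto (fun n => (φ (y + a n • B.e n) - φ y) - (φ (x + a n • B.e n) - φ x))
      atTop (𝓝 0)) {ε : ℝ} (hε : 0 < ε) :
    ¬ ∃ᶠ n in atTop, ε < φ (x + a n • B.e n) - φ x := by
  intro hf
  have hA : 0 ≤ A := (abs_nonneg _).trans (ha 0)
  -- `K` lies beyond all indices used so far, where `y` still has the coordinates of `x`; this keeps
  -- the norm bound independent of `k`.
  have key : ∀ k : ℕ, ∃ y : Z, ∃ K : ℕ, ‖y‖ ≤ ‖x‖ + A ∧ (∀ n, K ≤ n → B.f n y = B.f n x) ∧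
      φ x + k * (ε / 2) ≤ φ y := by
    intro k
    induction k with
    | zero => exact ⟨x, 0, by linarith, fun _ _ => rfl, by simp⟩
    | succ k ih =>
      obtain ⟨y, K, hy, hK, hφy⟩ := ih
      have hev : ∀ᶠ n in atTop,
          -(ε / 2) < (φ (y + a n • B.e n) - φ y) - (φ (x + a n • B.e n) - φ x) :=
        (hφ y).eventually (lt_mem_nhds (by linarith))
      obtain ⟨n, hn1, hn2, hn3⟩ := (hf.and_eventually (hev.and (eventually_ge_atTop K))).exists
      refine ⟨y + a n • B.e n, n + 1, ?_, ?_, ?_⟩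
      · refine (B.norm_add_le _ _ _).trans (max_le hy ?_)
        rw [hK n hn3]
        exact (abs_add_le _ _).trans (add_le_add (B.abs_le n x) (ha n))
      · intro j hj
        rw [map_add, map_smul, B.apply_ne (show j ≠ n by omega), smul_zero, add_zero]
        exact hK j (by omega)
      · push_cast
        linarith
  obtain ⟨M, hM⟩ := hb (‖x‖ + A)
  obtain ⟨k, hk⟩ := exists_nat_gt ((M - φ x) / (ε / 2))
  obtain ⟨y, -, hy, -, hφy⟩ := key k
  have h1 := (le_abs_self _).trans (hM y hy)
  rw [div_lt_iff₀ (by linarith)] at hk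
  linarith

theorem tendsto_of_isPolyDeg {a : ℕ → ℝ} {A : ℝ} (ha : ∀ n, |a n| ≤ A) (d : ℕ) :
    ∀ {φ : Z → ℝ}, IsPolyDeg d φ → (∀ R, ∃ M, ∀ x, ‖x‖ ≤ R → |φ x| ≤ M) →
      ∀ x, Tendsto (fun n => φ (x + a n • B.e n)) atTop (𝓝 (φ x)) := by
  have hA : 0 ≤ A := (abs_nonneg _).trans (ha 0)
  induction d with
  | zero =>
    intro φ hφ _ x
    simp only [fun n => hφ (x + a n • B.e n) x]
    exact tendsto_const_nhds
  | succ d ih =>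
    intro φ hφ hb x
    have hdiff : ∀ y, Tendsto
        (fun n => (φ (y + a n • B.e n) - φ y) - (φ (x + a n • B.e n) - φ x)) atTop (𝓝 0) := by
      intro y
      -- The increments at `y` and `x` differ by an increment of the lower-degree function `z ↦ φ (z
      -- + (y - x)) - φ z`.
      have h1 := ih (hφ (y - x)) (fun R => by
        obtain ⟨M, hM⟩ := hb (R + ‖y - x‖)
        refine ⟨M + M, fun z hz => (abs_sub _ _).trans (add_le_add (hM _ ?_) (hM _ ?_))⟩
        · exact (_root_.norm_add_le _ _).trans (by linarith)
        · linarith [norm_nonneg (y - x)]) x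
      have h2 := h1.sub_const (φ y - φ x)
      convert h2 using 2
      · rw [show x + a _ • B.e _ + (y - x) = y + a _ • B.e _ by abel]; ring
      · rw [show x + (y - x) = y by abel]; ring
    have hup := fun ε hε => B.not_frequently_lt hb ha x hdiff (ε := ε) hε
    have hlow := fun ε hε => B.not_frequently_lt (φ := fun z => -φ z)
      (by simpa using hb) ha x (by
        intro y
        have h2 := (hdiff y).neg
        rw [neg_zero] at h2
        convert h2 using 2
        ring) (ε := ε) hε
    rw [tendsto_order]
    constructor
    · intro b hbx
      have := not_frequently.mp (hlow ((φ x - b) / 2) (by linarith))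
      filter_upwards [this] with n hn
      linarith
    · intro b hbx
      have := not_frequently.mp (hup ((b - φ x) / 2) (by linarith))
      filter_upwards [this] with n hn
      linarith

/-- Coordinates are set one at a time, at an index so large that all strict inequalities survive; a
fresh index leaves the earlier coordinates intact. -/
theorem exists_perturbation {ι : Type*} [Finite ι] (φ : ι → Z → ℝ) (d : ℕ)
    (hφ : ∀ i, IsPolyDeg d (φ i)) (hb : ∀ i R, ∃ M, ∀ x, ‖x‖ ≤ R → |φ i x| ≤ M)
    (b : ι → ℝ) (x : ι → Z) (hx : ∀ i, ‖x i‖ ≤ 1) (hbx : ∀ i, b i < φ i (x i))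
    (θ : ℕ → ι → ℝ) (hθ : ∀ j i, |θ j i| ≤ 1) (N : ℕ) :
    ∃ (n : ℕ → ℕ) (y : ι → Z), (∀ i, ‖y i‖ ≤ 1) ∧ (∀ i, b i < φ i (y i)) ∧
      ∀ j < N, ∀ i, B.f (n j) (y i) = θ j i := by
  induction N with
  | zero => exact ⟨id, x, hx, hbx, fun j hj => absurd hj (Nat.not_lt_zero j)⟩
  | succ N ih =>
    obtain ⟨n, y, hy, hby, hf⟩ := ih
    have h1 : ∀ᶠ m in atTop, ∀ i, b i < φ i (y i + (θ N i - B.f m (y i)) • B.e m) := by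
      rw [eventually_all]
      intro i
      refine (B.tendsto_of_isPolyDeg (a := fun m => θ N i - B.f m (y i)) (A := 1 + 1)
        (fun m => ?_) d (hφ i) (hb i) (y i)).eventually (lt_mem_nhds (hby i))
      exact (abs_sub _ _).trans (add_le_add (hθ N i) ((B.abs_le m _).trans (hy i)))
    have h2 : ∀ᶠ m in atTop, ∀ j ∈ Finset.range N, n j ≠ m := by
      rw [eventually_all_finset]
      intro j _
      filter_upwards [eventually_gt_atTop (n j)] with m hm using hm.ne
    obtain ⟨m, hm1, hm2⟩ := (h1.and h2).exists
    refine ⟨Function.update n N m, fun i => y i + (θ N i - B.f m (y i)) • B.e m,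
      fun i => ?_, hm1, fun j hj i => ?_⟩
    · refine (B.norm_add_le _ _ _).trans (max_le (hy i) ?_)
      simpa using hθ N i
    · rcases Nat.lt_succ_iff_lt_or_eq.mp hj with hj | rfl
      · rw [Function.update_of_ne hj.ne, map_add, map_smul,
          B.apply_ne (hm2 j (Finset.mem_range.mpr hj)), smul_zero, add_zero]
        exact hf j hj i
      · simp [B.apply_self]

end SupSystem

/-! ### Functionals on the symmetric tensor product -/

namespace SymTensor

variable {N : ℕ} {Z : Type*} [NormedAddCommGroup Z] [NormedSpace ℝ Z]

theorem pow_smul (c : ℝ) (x : Z) : pow N (c • x) = c ^ N • pow N x := by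
  apply Subtype.ext
  have := (PiTensorProduct.tprod ℝ (s := fun _ : Fin N => Z)).map_smul_univ
    (fun _ => c) (fun _ => x)
  rw [Finset.prod_const, Finset.card_univ, Fintype.card_fin] at this
  exact this

theorem norm_pow_le_of_norm_eq_one {x : Z} (hx : ‖x‖ = 1) : ‖pow N x‖ ≤ 1 :=
  csInf_le (bddBelow_costs _) ⟨1, fun _ => 1, fun _ => x, fun _ => hx, by simp, by simp⟩

theorem norm_pow_le [Nontrivial Z] (x : Z) : ‖pow N x‖ ≤ ‖x‖ ^ N := by
  obtain ⟨v, hv, hxv⟩ : ∃ v : Z, ‖v‖ = 1 ∧ x = ‖x‖ • v := by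
    obtain ⟨e, he⟩ := exists_norm_eq Z (zero_le_one' ℝ)
    by_cases hx : x = 0
    · exact ⟨e, he, by simp [hx]⟩
    · have hx' : ‖x‖ ≠ 0 := norm_ne_zero_iff.mpr hx
      exact ⟨‖x‖⁻¹ • x, by simp [norm_smul, hx'], by simp [smul_smul, hx']⟩
  conv_lhs => rw [hxv, pow_smul, norm_smul]
  rw [norm_pow, norm_norm]
  exact mul_le_of_le_one_right (by positivity) (norm_pow_le_of_norm_eq_one hv)

theorem abs_le_of_unit [Nontrivial Z] (L : SymTensor N Z →ₗ[ℝ] ℝ) {C : ℝ}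
    (hL : ∀ x : Z, ‖x‖ = 1 → |L (pow N x)| ≤ C) (z : SymTensor N Z) : |L z| ≤ C * ‖z‖ := by
  obtain ⟨e, he⟩ := exists_norm_eq Z (zero_le_one' ℝ)
  have hC : 0 ≤ C := (abs_nonneg _).trans (hL e he)
  rw [norm_def, ← smul_eq_mul, ← Real.sInf_smul_of_nonneg hC]
  refine le_csInf ((costs_nonempty z).smul_set) ?_
  rintro _ ⟨r, ⟨k, c, x, hx, rfl, rfl⟩, rfl⟩
  simp only [map_sum, map_smul, smul_eq_mul, Finset.mul_sum]
  refine (Finset.abs_sum_le_sum_abs _ _).trans (Finset.sum_le_sum fun i _ => ?_)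
  rw [abs_mul, mul_comm]
  exact mul_le_mul_of_nonneg_right (hL _ (hx i)) (abs_nonneg _)

/-- The restriction of a functional on the completion to the algebraic symmetric tensor product. -/
noncomputable def restrict (g : StrongDual ℝ (SymProjTensor N Z)) : SymTensor N Z →ₗ[ℝ] ℝ :=
  g.toLinearMap ∘ₗ (UniformSpace.Completion.toComplL (𝕜 := ℝ) (E := SymTensor N Z)).toLinearMap

theorem exists_lt_abs [Nontrivial Z] (g : StrongDual ℝ (SymProjTensor N Z)) {c : ℝ}
    (hc : c < ‖g‖) : ∃ x : Z, ‖x‖ = 1 ∧ c < |g (pow N x : SymProjTensor N Z)| := by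
  by_contra! hcon
  obtain ⟨e, he⟩ := exists_norm_eq Z (zero_le_one' ℝ)
  have hc0 : 0 ≤ c := (abs_nonneg _).trans (hcon e he)
  refine absurd (g.opNorm_le_bound hc0 fun z => ?_) (not_le.mpr hc)
  induction z using UniformSpace.Completion.induction_on with
  | hp => exact isClosed_le (by fun_prop) (by fun_prop)
  | ih z =>
    rw [UniformSpace.Completion.norm_coe]
    exact abs_le_of_unit (restrict g) hcon z

/-- `L` extends linearly from the span to the full tensor product, where it becomes a multilinear
map; continuity plays no role. -/
theorem isPolyDeg_pow (L : SymTensor N Z →ₗ[ℝ] ℝ) : IsPolyDeg N (fun x : Z => L (pow N x)) := by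
  obtain ⟨G, hG⟩ := LinearMap.exists_extend
    (p := Submodule.span ℝ (Set.range (tensorPow N : Z → ⨂[ℝ] _ : Fin N, Z))) L
  have h := IsPolyDeg.multilinear_diag (G.compMultilinearMap (PiTensorProduct.tprod ℝ))
  convert h using 2 with x
  rw [← hG]
  rfl

/-- The functional on the symmetric tensor product induced by the `N`-homogeneous polynomial
`x ↦ ∏ j, f j x`. -/
def prodFunctional (f : Fin N → Z →ₗ[ℝ] ℝ) : SymTensor N Z →ₗ[ℝ] ℝ :=
  (PiTensorProduct.lift
    ((MultilinearMap.mkPiAlgebra ℝ (Fin N) ℝ).compLinearMap f)).comp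
      (Submodule.subtype (Submodule.span ℝ (Set.range (tensorPow N : Z → ⨂[ℝ] _ : Fin N, Z))))

theorem prodFunctional_pow (f : Fin N → Z →ₗ[ℝ] ℝ) (x : Z) :
    prodFunctional f (pow N x) = ∏ j, f j x := by
  change PiTensorProduct.lift _ (PiTensorProduct.tprod ℝ (fun _ => x)) = _
  simp

theorem abs_prodFunctional_le [Nontrivial Z] {f : Fin N → Z →ₗ[ℝ] ℝ}
    (hf : ∀ j x, |f j x| ≤ ‖x‖) (z : SymTensor N Z) : |prodFunctional f z| ≤ ‖z‖ := by
  rw [← one_mul ‖z‖]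
  refine abs_le_of_unit _ (fun x hx => ?_) z
  rw [prodFunctional_pow, Finset.abs_prod]
  exact Finset.prod_le_one (fun _ _ => abs_nonneg _) fun j _ => (hf j x).trans hx.le

end SymTensor

/-! ### Strong diameter two from a sup-norm system -/

theorem SupSystem.nontrivial {Z : Type*} [NormedAddCommGroup Z] [NormedSpace ℝ Z]
    (B : SupSystem Z) : Nontrivial Z :=
  ⟨B.e 0, 0, fun h => by simpa [h] using B.apply_self 0⟩

theorem SupSystem.strongDiameterTwo {Z : Type*} [NormedAddCommGroup Z] [NormedSpace ℝ Z]
    (B : SupSystem Z) {N : ℕ} (hN : 1 ≤ N) : StrongDiameterTwo (SymProjTensor N Z) := by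
  intro k g α l hg hα hl hl1
  have := B.nontrivial
  obtain ⟨N, rfl⟩ := Nat.exists_eq_add_of_le' hN
  set D := {z : SymProjTensor (N + 1) Z | ∃ s : Fin k → SymProjTensor (N + 1) Z,
        (∀ i, s i ∈ ballSlice (g i) (α i)) ∧ z = ∑ i, l i • s i}
  have hball : ∀ z ∈ D, ‖z‖ ≤ 1 := by
    rintro z ⟨s, hs, rfl⟩
    refine (norm_sum_le _ _).trans ((Finset.sum_le_sum fun i _ => ?_).trans_eq hl1)
    rw [norm_smul, Real.norm_of_nonneg (hl i)]
    exact mul_le_of_le_one_right (hl i) (hs i).1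
  have hdist : ∀ z ∈ D, ∀ w ∈ D, dist z w ≤ 2 := fun z hz w hw => by
    rw [dist_eq_norm]
    exact (norm_sub_le _ _).trans (by linarith [hball z hz, hball w hw])
  refine le_antisymm (Metric.diam_le_of_forall_dist_le zero_le_two hdist) ?_
  have hx : ∀ i, ∃ x : Z, ∃ σ : ℝ, ‖x‖ = 1 ∧ |σ| = 1 ∧
      1 - α i < σ * g i (SymTensor.pow (N + 1) x : SymProjTensor (N + 1) Z) := by
    intro i
    obtain ⟨x, hx, hlt⟩ := SymTensor.exists_lt_abs (g i) (c := 1 - α i)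
      (by rw [hg i]; linarith [hα i])
    rcases abs_cases (g i (SymTensor.pow (N + 1) x : SymProjTensor (N + 1) Z)) with h | h
    · exact ⟨x, 1, hx, by simp, by linarith⟩
    · exact ⟨x, -1, hx, by simp, by linarith⟩
  choose x σ hx hσ hlt using hx
  let τ : Bool → ℝ := fun b => if b then 1 else -1
  have hτ : ∀ b, |τ b| = 1 := by simp [τ]
  -- Both signs `b` are perturbed together so that they share the indices `n j`, hence the same
  -- separating functional.
  obtain ⟨n, y, hy, hby, hf⟩ := B.exists_perturbation (ι := Fin k × Bool)
    (fun i z => (σ i.1 • SymTensor.restrict (g i.1)) (SymTensor.pow (N + 1) z)) (N + 1)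
    (fun i => SymTensor.isPolyDeg_pow _)
    (fun i R => ⟨R ^ (N + 1), fun z hz => by
      rw [LinearMap.smul_apply, smul_eq_mul, abs_mul, hσ, one_mul]
      refine ((g i.1).le_opNorm _).trans ?_
      rw [hg, one_mul]
      refine (UniformSpace.Completion.norm_coe _).trans_le ?_
      exact (SymTensor.norm_pow_le z).trans (pow_le_pow_left₀ (norm_nonneg _) hz _)⟩)
    (fun i => 1 - α i.1) (fun i => x i.1) (fun i => (hx i.1).le) (fun i => hlt i.1)
    -- The factor `j = 0`, available as the degree is positive, carries the whole sign; `σ` cancels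
    -- the sign of the slice point.
    (fun j i => if j = 0 then σ i.1 * τ i.2 else 1)
    (fun j i => by
      split_ifs
      · rw [abs_mul, hσ, hτ, one_mul]
      · simp) (N + 1)
  let w : Bool → SymTensor (N + 1) Z :=
    fun b => ∑ i, l i • σ i • SymTensor.pow (N + 1) (y (i, b))
  have hw : ∀ b, (w b : SymProjTensor (N + 1) Z) ∈ D := by
    intro b
    refine ⟨fun i => ((σ i • SymTensor.pow (N + 1) (y (i, b)) : SymTensor (N + 1) Z) :
      SymProjTensor (N + 1) Z), fun i => ⟨?_, ?_⟩, ?_⟩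
    · rw [UniformSpace.Completion.norm_coe, norm_smul, Real.norm_eq_abs, hσ, one_mul]
      exact (SymTensor.norm_pow_le _).trans (pow_le_one₀ (norm_nonneg _) (hy _))
    · have := hby (i, b)
      rwa [LinearMap.smul_apply, ← map_smul] at this
    · change UniformSpace.Completion.toComplL (𝕜 := ℝ) (w b) = _
      rw [map_sum]
      exact Finset.sum_congr rfl fun i _ => map_smul _ _ _
  have hQ : ∀ b, SymTensor.prodFunctional (fun j : Fin (N + 1) => B.f (n j)) (w b) = τ b := by
    intro b
    simp only [w, map_sum, map_smul, SymTensor.prodFunctional_pow, smul_eq_mul]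
    have hprod : ∀ i, ∏ j : Fin (N + 1), B.f (n j) (y (i, b)) = σ i * τ b := by
      intro i
      rw [Fin.prod_univ_succ, hf _ (by simp)]
      rw [Finset.prod_congr rfl fun j _ => hf (j.succ : Fin (N + 1)) (Fin.is_lt _) (i, b)]
      simp
    have hσσ : ∀ i, σ i * σ i = 1 := fun i => by rw [← abs_mul_abs_self, hσ, one_mul]
    simp only [hprod, ← mul_assoc (σ _), hσσ, one_mul, ← Finset.sum_mul, hl1]
  refine le_trans ?_ (Metric.dist_le_diam_of_mem
    (Metric.isBounded_iff.mpr ⟨2, fun z hz w hw => hdist z hz w hw⟩) (hw true) (hw false))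
  rw [dist_eq_norm, ← UniformSpace.Completion.coe_sub, UniformSpace.Completion.norm_coe]
  refine le_trans ?_ (SymTensor.abs_prodFunctional_le (fun j => B.abs_le (n j)) _)
  rw [map_sub, hQ, hQ]
  norm_num [τ]

/-! ### The equivalent norm -/

/-- The supremum of the absolute values of a sequence of functionals and of the quotient norm
modulo `E`. -/
noncomputable def supQuotientSeminorm {X : Type*} [NormedAddCommGroup X] [NormedSpace ℝ X]
    (E : Submodule ℝ X) (f : ℕ → StrongDual ℝ X) : Seminorm ℝ X :=
  (⨆ n, (normSeminorm ℝ ℝ).comp (f n).toLinearMap) ⊔ (normSeminorm ℝ (X ⧸ E)).comp E.mkQ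

section Renorming

variable {X : Type*} [NormedAddCommGroup X] [NormedSpace ℝ X] {E : Submodule ℝ X}
  {f : ℕ → StrongDual ℝ X} {K : ℝ}

theorem bddAbove_range_abs (hf : ∀ n, ‖f n‖ ≤ K) (x : X) :
    BddAbove (Set.range fun n => |f n x|) :=
  ⟨K * ‖x‖, by rintro _ ⟨n, rfl⟩; exact (f n).le_of_opNorm_le (hf n) x⟩

theorem supQuotientSeminorm_apply (hf : ∀ n, ‖f n‖ ≤ K) (x : X) :
    supQuotientSeminorm E f x = max (⨆ n, |f n x|) ‖E.mkQ x‖ := by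
  rw [supQuotientSeminorm, Seminorm.sup_apply, Seminorm.iSup_apply]
  · rfl
  · rw [Seminorm.bddAbove_range_iff]
    exact bddAbove_range_abs hf

theorem abs_le_supQuotientSeminorm (hf : ∀ n, ‖f n‖ ≤ K) (n : ℕ) (x : X) :
    |f n x| ≤ supQuotientSeminorm E f x := by
  rw [supQuotientSeminorm_apply hf]
  exact (le_ciSup (bddAbove_range_abs hf x) n).trans (le_max_left _ _)

theorem supQuotientSeminorm_le (hf : ∀ n, ‖f n‖ ≤ K) (x : X) :
    supQuotientSeminorm E f x ≤ max K 1 * ‖x‖ := by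
  rw [supQuotientSeminorm_apply hf]
  refine max_le (ciSup_le fun n => ?_) ?_
  · exact (f n).le_of_opNorm_le ((hf n).trans (le_max_left _ _)) x
  · refine (Submodule.Quotient.norm_mk_le E x).trans ?_
    exact le_mul_of_one_le_left (norm_nonneg x) (le_max_right _ _)

/-- Write `x = (x - w) + w` with `w` a nearly minimal representative of `x + E`; the functionals
control `x - w ∈ E`, the quotient norm controls `w`. -/
theorem norm_le_supQuotientSeminorm (hf : ∀ n, ‖f n‖ ≤ K) {M : ℝ} (hM : 0 ≤ M)
    (hE : ∀ u ∈ E, ‖u‖ ≤ M * ⨆ n, |f n u|) (x : X) :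
    ‖x‖ ≤ (M + (M * K + 1)) * supQuotientSeminorm E f x := by
  have hK : 0 ≤ K := (norm_nonneg _).trans (hf 0)
  have hq : ‖E.mkQ x‖ ≤ supQuotientSeminorm E f x := by
    rw [supQuotientSeminorm_apply hf]; exact le_max_right _ _
  set P := supQuotientSeminorm E f x
  have hstep : ∀ ε > 0, ‖x‖ ≤ M * P + (M * K + 1) * (P + ε) := by
    intro ε hε
    obtain ⟨w, hw, hwlt⟩ : ∃ w : X, E.mkQ w = E.mkQ x ∧ ‖w‖ < ‖E.mkQ x‖ + ε :=
      Submodule.Quotient.norm_mk_lt (E.mkQ x) hε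
    have hu : x - w ∈ E := by
      rw [← Submodule.ker_mkQ E, LinearMap.mem_ker, map_sub, hw, sub_self]
    have hsup : ⨆ n, |f n (x - w)| ≤ P + K * ‖w‖ := by
      refine ciSup_le fun n => ?_
      rw [map_sub]
      exact (abs_sub _ _).trans (add_le_add (abs_le_supQuotientSeminorm hf n x)
        ((f n).le_of_opNorm_le (hf n) w))
    have h1 : ‖x‖ ≤ ‖x - w‖ + ‖w‖ := by simpa using norm_add_le (x - w) w
    have h2 := (hE _ hu).trans (mul_le_mul_of_nonneg_left hsup hM)
    have h3 : (M * K + 1) * ‖w‖ ≤ (M * K + 1) * (P + ε) :=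
      mul_le_mul_of_nonneg_left (by linarith) (by positivity)
    linarith
  have hlim : Tendsto (fun ε => M * P + (M * K + 1) * (P + ε)) (𝓝[>] 0)
      (𝓝 (M * P + (M * K + 1) * (P + 0))) :=
    (Continuous.tendsto (by fun_prop) 0).mono_left nhdsWithin_le_nhds
  have := ge_of_tendsto hlim (eventually_mem_nhdsWithin.mono hstep)
  linarith

theorem supQuotientSeminorm_add_smul_le (hf : ∀ n, ‖f n‖ ≤ K) {e : ℕ → X} (he : ∀ n, e n ∈ E)
    (hself : ∀ n, f n (e n) = 1) (hne : ∀ m n, m ≠ n → f m (e n) = 0) (x : X) (n : ℕ) (a : ℝ) :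
    supQuotientSeminorm E f (x + a • e n) ≤ max (supQuotientSeminorm E f x) |f n x + a| := by
  rw [supQuotientSeminorm_apply hf (x + a • e n)]
  refine max_le (ciSup_le fun m => ?_) (le_max_of_le_left ?_)
  · by_cases hm : m = n
    · subst hm
      rw [map_add, map_smul, hself, smul_eq_mul, mul_one]
      exact le_max_right _ _
    · rw [map_add, map_smul, hne m n hm, smul_zero, add_zero]
      exact (abs_le_supQuotientSeminorm hf m x).trans (le_max_left _ _)
  · have h0 : E.mkQ (e n) = 0 := by
      rw [← LinearMap.mem_ker, Submodule.ker_mkQ]; exact he n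
    rw [map_add, map_smul, h0, smul_zero, add_zero, supQuotientSeminorm_apply hf]
    exact le_max_right _ _

end Renorming

/-! ### Biorthogonal functionals from a copy of `c₀` -/

/-- The `n`-th unit vector of `c₀`. -/
noncomputable def c0Single (n : ℕ) : C₀(ℕ, ℝ) where
  toFun := Pi.single n 1
  continuous_toFun := continuous_of_discreteTopology
  zero_at_infty' := by
    rw [cocompact_eq_cofinite, Nat.cofinite_eq_atTop]
    refine tendsto_const_nhds.congr' ?_
    filter_upwards [eventually_gt_atTop n] with m hm
    rw [Pi.single_eq_of_ne hm.ne']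

/-- The `n`-th coordinate functional of `c₀`. -/
noncomputable def c0Coord (n : ℕ) : StrongDual ℝ C₀(ℕ, ℝ) :=
  LinearMap.mkContinuous
    { toFun := fun u => u n
      map_add' := fun _ _ => rfl
      map_smul' := fun _ _ => rfl } 1
    (fun u => by rw [one_mul]; exact u.toBCF.norm_coe_le_norm n)

theorem c0Coord_apply (n : ℕ) (u : C₀(ℕ, ℝ)) : c0Coord n u = u n := rfl

theorem norm_c0Coord_le (n : ℕ) : ‖c0Coord n‖ ≤ 1 :=
  LinearMap.mkContinuous_norm_le _ zero_le_one _

theorem c0_norm_le_iSup (u : C₀(ℕ, ℝ)) : ‖u‖ ≤ ⨆ n, |u n| := by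
  rw [← ZeroAtInftyContinuousMap.norm_toBCF_eq_norm, BoundedContinuousFunction.norm_eq_iSup_norm]
  rfl

theorem ContainsC0.exists_biorthogonal {X : Type*} [NormedAddCommGroup X] [NormedSpace ℝ X]
    (hX : ContainsC0 X) : ∃ (E : Submodule ℝ X) (e : ℕ → X) (f : ℕ → StrongDual ℝ X) (K M : ℝ),
      (∀ n, e n ∈ E) ∧ (∀ n, f n (e n) = 1) ∧ (∀ m n, m ≠ n → f m (e n) = 0) ∧
      (∀ n, ‖f n‖ ≤ K) ∧ 0 ≤ M ∧ ∀ u ∈ E, ‖u‖ ≤ M * ⨆ n, |f n u| := by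
  obtain ⟨E, ⟨T⟩⟩ := hX
  choose f hf hfn using fun n => exists_extension_norm_eq E
    ((c0Coord n).comp (T.symm : E →L[ℝ] C₀(ℕ, ℝ)))
  have hfT : ∀ n (u : C₀(ℕ, ℝ)), f n (T u) = u n := fun n u => by
    rw [hf]; simp [c0Coord_apply]
  refine ⟨E, fun n => T (c0Single n), f, ‖(T.symm : E →L[ℝ] C₀(ℕ, ℝ))‖,
    ‖(T : C₀(ℕ, ℝ) →L[ℝ] E)‖, fun n => (T (c0Single n)).2, fun n => ?_, fun m n hmn => ?_,
    fun n => ?_, ContinuousLinearMap.opNorm_nonneg _, fun u hu => ?_⟩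
  · rw [hfT]; exact Pi.single_eq_same n 1
  · rw [hfT]; exact Pi.single_eq_of_ne hmn 1
  · rw [hfn]
    refine (ContinuousLinearMap.opNorm_comp_le _ _).trans ?_
    exact mul_le_of_le_one_left (norm_nonneg _) (norm_c0Coord_le n)
  · obtain ⟨v, hv⟩ := T.surjective ⟨u, hu⟩
    obtain rfl : (T v : X) = u := congrArg Subtype.val hv
    simp only [hfT]
    exact ((T : C₀(ℕ, ℝ) →L[ℝ] E).le_opNorm v).trans
      (mul_le_mul_of_nonneg_left (c0_norm_le_iSup v) (norm_nonneg _))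

theorem ContainsC0.exists_supSystem {X : Type*} [NormedAddCommGroup X] [NormedSpace ℝ X]
    (hX : ContainsC0 X) : ∃ p : EquivalentNorm X, Nonempty (SupSystem (Renormed p)) := by
  obtain ⟨E, e, f, K, M, he, hself, hne, hf, hM, hE⟩ := hX.exists_biorthogonal
  have hK : 0 ≤ K := (norm_nonneg _).trans (hf 0)
  have hpos : 0 < M + (M * K + 1) := by positivity
  let p : EquivalentNorm X :=
    { toSeminorm := supQuotientSeminorm E f
      lower := ⟨(M + (M * K + 1))⁻¹, inv_pos.mpr hpos, fun x => by
        rw [inv_mul_le_iff₀ hpos]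
        exact norm_le_supQuotientSeminorm hf hM hE x⟩
      upper := ⟨max K 1, supQuotientSeminorm_le hf⟩ }
  exact ⟨p, ⟨{
    e := e
    f := fun n => (f n).toLinearMap
    apply_self := hself
    apply_ne := fun {m n} h => hne m n h
    abs_le := abs_le_supQuotientSeminorm hf
    norm_add_le := supQuotientSeminorm_add_smul_le hf he hself hne }⟩⟩

theorem corollary3p5 {X : Type*} [NormedAddCommGroup X] [NormedSpace ℝ X] [CompleteSpace X]
    (hX : ContainsC0 X) :
    ∃ p : EquivalentNorm X, ∀ N : ℕ, 1 ≤ N →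
      StrongDiameterTwo (SymProjTensor N (Renormed p)) := by
  obtain ⟨p, ⟨B⟩⟩ := hX.exists_supSystem
  exact ⟨p, fun N hN => B.strongDiameterTwo hN⟩
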